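/- Sequences are indexed by $\mathbb{N}=\{1,2,3,\dots\}$. For $\delta\in(0,1]$, a sequence $a:\mathbb{N}\to\mathbb{R}$ is called $\delta$-scattered if there is $\varepsilon>0$ such that for every sufficiently large $N$, $$\frac1{N^2}\sum_{1\le m<n\le N}\min\big(|a(n)-a(m)|^{-\delta},\,1\big)\le\frac1{(\log N)^{1+\varepsilon}},$$ where the minimum is understood to be $1$ if $a(n)=a(m)$. The sequence $a$ is called scattered if it is $\delta$-scattered for every $\delta\in(0,1]$. Sequences $a_1,\dots,a_k:\mathbb{N}\to\mathbb{R}$ are called jointly scattered if for every non-zero $v=(v_1,\dots,v_k)\in\mathbb{R}^k$ the sequence $v_1a_1+\dots+v_ka_k$ is scattered. A sequence $(x_n)_{n\in\mathbb{N}}$ in $\mathbb{R}^k$ is called uniformly distributed in $\mathbb{T}^k=\mathbb{R}^k/\mathbb{Z}^k$ if for all intervals $I_1,\dots,I_k\subset[0,1]$, $$\lim_{N\to\infty}\frac1N\big|\{n\in\{1,\dots,N\}:\{x_n\}\in I_1\times\dots\times I_k\}\big|=\mu(I_1\times\dots\times I_k),$$ where $\mu$ is the $k$-dimensional Lebesgue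 measure and $\{x_n\}$ is the vector of fractional parts of the coordinates of $x_n$. Theorem. Let $k\ge1$ be an integer, let $f_1,\dots,f_k:\mathbb{R}\to\mathbb{R}$ be non-constant real-analytic functions, and let $a_1,\dots,a_k:\mathbb{N}\to\mathbb{R}$ be scattered sequences. Assume that at least one of the following holds: 1. the sequences $a_1,\dots,a_k$ are jointly scattered; 2. the $k+1$ functions $1,f_1,\dots,f_k$ are linearly independent over $\mathbb{R}$. Then for Lebesgue-almost every $x\in\mathbb{R}$ the sequence $\big(a_1(n)f_1(x),\dots,a_k(n)f_k(x)\big)_{n\in\mathbb{N}}$ is uniformly distributed in $\mathbb{T}^k$. -/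

import Mathlib

open Filter Topology MeasureTheory

noncomputable section

/-- The weight `min (|t|^(-δ), 1)`, with the convention `0^(-δ) = ∞`, so that its value at
`t = 0` is `1`. (The convention is spelled out because `(0 : ℝ) ^ (-δ) = 0` in Mathlib.) -/
def pairWeight (δ t : ℝ) : ℝ :=
  if t = 0 then 1 else min (|t| ^ (-δ)) 1

/-- Sequences are indexed by the positive integers: of `a : ℕ → ℝ` only the values `a n` with
`1 ≤ n` are used. The sum runs over all pairs `1 ≤ m < n ≤ N`. -/
def IsDeltaScattered (δ : ℝ) (a : ℕ → ℝ) : Prop :=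
  ∃ ε : ℝ, 0 < ε ∧ ∀ᶠ N : ℕ in atTop,
    1 / (N : ℝ) ^ 2 * ∑ n ∈ Finset.Icc 1 N, ∑ m ∈ Finset.Ico 1 n, pairWeight δ (a n - a m)
      ≤ 1 / Real.log N ^ (1 + ε)

/-- Scattered: `δ`-scattered for every `δ ∈ (0, 1]`. -/
def IsScattered (a : ℕ → ℝ) : Prop :=
  ∀ δ : ℝ, 0 < δ → δ ≤ 1 → IsDeltaScattered δ a

/-- Jointly scattered: every non-trivial real linear combination is scattered. -/
def JointlyScattered {k : ℕ} (a : Fin k → ℕ → ℝ) : Prop :=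
  ∀ v : Fin k → ℝ, v ≠ 0 → IsScattered (fun n => ∑ i, v i * a i n)

open scoped Classical in
/-- Uniform distribution modulo 1 of the sequence `x 1, x 2, …` in `ℝ^k` (equivalently, of its
projection to `𝕋^k`): the frequency of visits of the fractional parts to any box
`I 1 × ⋯ × I k`, with `I i ⊆ [0, 1]` intervals of any kind, tends to the Lebesgue measure of
the box. -/
def IsUniformlyDistributedModOne {k : ℕ} (x : ℕ → Fin k → ℝ) : Prop :=
  ∀ I : Fin k → Set ℝ, (∀ i, (I i).OrdConnected ∧ I i ⊆ Set.Icc 0 1) →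
    Tendsto
      (fun N : ℕ =>
        1 / (N : ℝ) *
          (((Finset.Icc 1 N).filter
            (fun n => (fun i => Int.fract (x n i)) ∈ Set.univ.pi I)).card : ℝ))
      atTop (𝓝 (volume.real (Set.univ.pi I)))

end

/-!
By Weyl's criterion it suffices to show, for each non-zero `v ∈ ℤᵏ`, that for almost every `x` the
averages of `e(∑ i, v i * a i n * f i x)` over `1 ≤ n ≤ N` tend to `0`, where `e(t) = exp (2πit)`.

Modulo constants, the functions `f i` are combinations of a subfamily `g` such that no non-trivial
combination of `g` is constant (`exists_subfamily_independent_mod_const`; if `1, f 1, …, f k` are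
linearly independent, then `g = f`). So the phase is `γ n + ∑ j, β j n * g j x`, and under either
hypothesis at least one of the sequences `β j` is scattered. Expanding the square, the mean square
of the average over a bounded interval is a mean over pairs `(n, m)` of oscillatory integrals with
phase `∑ j, B j * g j`, where `B = β n - β m`. Such an integral is `O(min (‖B‖ ^ (-δ), 1))` for
some `δ > 0` (`exists_norm_integral_exp_le_pairWeight`), because by analyticity and compactness one
of finitely many derivatives of the normalized phase is bounded below at each point. Scatteredness
of `β j` then makes the mean square `O((log N) ^ (-1 - ε))`. This is summable along `N = ⌊c ^ q⌋`,
which gives convergence almost everywhere along these `N`; letting `c → 1` fills the gaps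
(`ae_tendsto_average_zero`).

The decay of oscillatory integrals is proved by a smooth multi-scale version of van der Corput's
argument (`norm_integral_exp_le_rpow`), which needs neither monotonicity of derivatives nor any
count of the intervals on which they are small.
-/

/-! ### Oscillatory integrals -/

/-- Integration by parts against the cutoff `p / (p ^ 2 + η ^ 2)`, a smooth substitute for `1 / p`:
up to the factor `p ^ 2 / (p ^ 2 + η ^ 2)`, which removes the zeros of `p`, a function whose product
with `p` has a small primitive has a small integral. -/
lemma norm_integral_cutoff_smul_le {E : Type*} [NormedAddCommGroup E] [NormedSpace ℝ E]
    [CompleteSpace E] {a b : ℝ} (hab : a ≤ b) {p p' : ℝ → ℝ} {G g : ℝ → E} {K M η : ℝ}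
    (hp : ∀ x, HasDerivAt p (p' x) x) (hp' : Continuous p') (hM : ∀ x ∈ Set.Icc a b, |p' x| ≤ M)
    (hG : ∀ x, HasDerivAt G (p x • g x) x) (hg : Continuous g) (hK : ∀ x, ‖G x‖ ≤ K)
    (hη : 0 < η) :
    ‖∫ x in a..b, (p x ^ 2 / (p x ^ 2 + η ^ 2)) • g x‖ ≤ K * (1 / η + M * (b - a) / η ^ 2) := by
  have hpos : ∀ x, 0 < p x ^ 2 + η ^ 2 := fun x => by positivity
  have hpc : Continuous p := continuous_iff_continuousAt.2 fun x => (hp x).continuousAt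
  have hGc : Continuous G := continuous_iff_continuousAt.2 fun x => (hG x).continuousAt
  have hK0 : 0 ≤ K := (norm_nonneg _).trans (hK 0)
  set w : ℝ → ℝ := fun x => p x / (p x ^ 2 + η ^ 2) with hw
  set w' : ℝ → ℝ := fun x => p' x * (η ^ 2 - p x ^ 2) / (p x ^ 2 + η ^ 2) ^ 2 with hw'
  have hwd : ∀ x, HasDerivAt w (w' x) x := by
    intro x
    have h1 := (hp x).div (((hp x).pow 2).add_const (η ^ 2)) (hpos x).ne'
    refine h1.congr_deriv ?_
    simp only [hw', Pi.pow_apply]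
    congr 1
    push_cast
    ring
  have hwc : Continuous w := continuous_iff_continuousAt.2 fun x => (hwd x).continuousAt
  have hwc' : Continuous w' := by
    apply Continuous.div (by fun_prop) (by fun_prop)
    intro x
    exact pow_ne_zero _ (hpos x).ne'
  have hwb : ∀ x, |w x| ≤ 1 / (2 * η) := by
    intro x
    rw [hw]
    simp only
    rw [abs_div, abs_of_pos (hpos x), div_le_div_iff₀ (hpos x) (by positivity)]
    nlinarith [sq_nonneg (|p x| - η), sq_abs (p x)]
  have hwb' : ∀ x ∈ Set.Icc a b, |w' x| ≤ M / η ^ 2 := by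
    intro x hx
    rw [hw']
    simp only
    rw [abs_div, abs_mul, abs_of_pos (pow_pos (hpos x) 2), div_le_div_iff₀ (by positivity)
      (by positivity)]
    have h1 : |η ^ 2 - p x ^ 2| ≤ p x ^ 2 + η ^ 2 := by
      rw [abs_le]; constructor <;> nlinarith [sq_nonneg (p x), sq_nonneg η]
    have h2 : |η ^ 2 - p x ^ 2| * η ^ 2 ≤ (p x ^ 2 + η ^ 2) ^ 2 := by
      rw [sq (p x ^ 2 + η ^ 2)]
      exact mul_le_mul h1 (by nlinarith [sq_nonneg (p x)]) (by positivity) (hpos x).le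
    calc |p' x| * |η ^ 2 - p x ^ 2| * η ^ 2 = |p' x| * (|η ^ 2 - p x ^ 2| * η ^ 2) := by ring
      _ ≤ M * (p x ^ 2 + η ^ 2) ^ 2 :=
        mul_le_mul (hM x hx) h2 (by positivity) ((abs_nonneg _).trans (hM x hx))
  have key := intervalIntegral.integral_smul_deriv_eq_deriv_smul_of_hasDerivAt
    (a := a) (b := b) (u := w) (v := G) (u' := w') (v' := fun x => p x • g x)
    hwc.continuousOn hGc.continuousOn (fun x _ => hwd x) (fun x _ => hG x)
    (hwc'.intervalIntegrable _ _) ((hpc.smul hg).intervalIntegrable _ _)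
  have e1 : ∀ x, (p x ^ 2 / (p x ^ 2 + η ^ 2)) • g x = w x • p x • g x := by
    intro x
    rw [smul_smul, hw]
    congr 1
    ring
  simp_rw [e1, key]
  have b1 : ∀ x, ‖w x • G x‖ ≤ 1 / (2 * η) * K := fun x => by
    rw [norm_smul, Real.norm_eq_abs]
    exact mul_le_mul (hwb x) (hK x) (norm_nonneg _) (by positivity)
  have b2 : ‖∫ x in a..b, w' x • G x‖ ≤ M / η ^ 2 * K * |b - a| := by
    apply intervalIntegral.norm_integral_le_of_norm_le_const
    intro x hx
    rw [Set.uIoc_of_le hab] at hx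
    have hx' := Set.Ioc_subset_Icc_self hx
    rw [norm_smul, Real.norm_eq_abs]
    exact mul_le_mul (hwb' x hx') (hK x) (norm_nonneg _) ((abs_nonneg _).trans (hwb' x hx'))
  rw [abs_of_nonneg (sub_nonneg.2 hab)] at b2
  calc _ ≤ ‖w b • G b‖ + ‖w a • G a‖ + ‖∫ x in a..b, w' x • G x‖ :=
        (norm_sub_le _ _).trans (add_le_add_left (norm_sub_le _ _) _)
    _ ≤ 1 / (2 * η) * K + 1 / (2 * η) * K + M / η ^ 2 * K * (b - a) :=
        add_le_add (add_le_add (b1 b) (b1 a)) b2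
    _ = _ := by field_simp; ring

/-- A multi-scale form of van der Corput's lemma. If at each point of `[a, b]` one of the first `r`
derivatives of `φ 0` is bounded below, then `∫ e(t φ)` decays like `t ^ (-3⁻ʳ)`. The scales
`η j = t ^ (-3⁻ʲ)` are chosen so that `η j = η (j + 1) ^ 3`; on the set where
`|φ j| ≲ η j` for all `1 ≤ j ≤ s`, the part where `|φ (s + 1)| ≳ η (s + 1)` is handled by
integration by parts, and for `s = r` nothing is left. Since smooth weights are used in place of
these sets, no monotonicity of the derivatives is needed. -/
lemma norm_integral_exp_le_rpow {a b : ℝ} (hab : a ≤ b) {φ : ℕ → ℝ → ℝ}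
    (hφ : ∀ j x, HasDerivAt (φ j) (φ (j + 1) x) x) {r : ℕ} {c M : ℝ} (hc : 0 < c)
    (hM : ∀ j ≤ r, ∀ x ∈ Set.Icc a b, |φ (j + 1) x| ≤ M)
    (hlow : ∀ x ∈ Set.Icc a b, c ≤ ∑ j ∈ Finset.Icc 1 r, φ j x ^ 2) {t : ℝ} (ht : 1 ≤ t) :
    ‖∫ x in a..b, Complex.exp (2 * Real.pi * Complex.I * (t * φ 0 x : ℝ))‖
      ≤ (2 * (1 + M * (b - a)) * r + (b - a) * (r / c)) * t ^ (-(1 / 3 : ℝ) ^ r) := by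
  have ht0 : 0 < t := by linarith
  have hM0 : 0 ≤ M := (abs_nonneg _).trans (hM 0 (Nat.zero_le _) a (Set.left_mem_Icc.2 hab))
  have hL : 0 ≤ b - a := sub_nonneg.2 hab
  have hr : 1 ≤ r := by
    by_contra hr
    have : r = 0 := by omega
    subst this
    have := hlow a (Set.left_mem_Icc.2 hab)
    simp at this
    linarith
  have hcont : ∀ j, Continuous (φ j) := fun j =>
    continuous_iff_continuousAt.2 fun x => (hφ j x).continuousAt
  set η : ℕ → ℝ := fun j => t ^ (-(1 / 3 : ℝ) ^ j) with hη
  have hη0 : ∀ j, 0 < η j := fun j => Real.rpow_pos_of_pos ht0 _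
  have hη1 : ∀ j, η j ≤ 1 := fun j =>
    Real.rpow_le_one_of_one_le_of_nonpos ht (by simp)
  have hη3 : ∀ j, η j = η (j + 1) ^ 3 := by
    intro j
    rw [hη]
    simp only
    rw [← Real.rpow_mul_natCast ht0.le, pow_succ]
    congr 1
    push_cast
    ring
  have hηmono : ∀ j ≤ r, η j ≤ η r := fun j hj => by
    apply Real.rpow_le_rpow_of_exponent_le ht
    apply neg_le_neg
    exact pow_le_pow_of_le_one (by norm_num) (by norm_num) hj
  set q : ℕ → ℝ → ℝ := fun j x => η j ^ 2 / (φ j x ^ 2 + η j ^ 2) with hq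
  have hpos : ∀ j x, 0 < φ j x ^ 2 + η j ^ 2 := fun j x => by
    have := hη0 j; positivity
  have hq0 : ∀ j x, 0 ≤ q j x := fun j x => by
    have := hη0 j; simp only [hq]; positivity
  have hq1 : ∀ j x, q j x ≤ 1 := fun j x => by
    simp only [hq]; rw [div_le_one (hpos j x)]; nlinarith [sq_nonneg (φ j x)]
  have hqc : ∀ j, Continuous (q j) := fun j => by
    apply Continuous.div continuous_const (by have := hcont j; fun_prop) (fun x => (hpos j x).ne')
  have hq' : ∀ j x, φ j x ^ 2 / (φ j x ^ 2 + η j ^ 2) = 1 - q j x := fun j x => by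
    simp only [hq]; rw [eq_sub_iff_add_eq, ← add_div, div_self (hpos j x).ne']
  set W : ℕ → ℝ → ℝ := fun s x => ∏ j ∈ Finset.Icc 1 s, q j x with hW
  have hWc : ∀ s, Continuous (W s) := fun s => continuous_finsetProd _ fun j _ => hqc j
  have hWle : ∀ s x, ∀ j ∈ Finset.Icc 1 s, W s x ≤ q j x := by
    intro s x j hj
    simp only [hW]
    rw [← Finset.mul_prod_erase _ _ hj]
    exact mul_le_of_le_one_right (hq0 j x)
      (Finset.prod_le_one (fun i _ => hq0 i x) fun i _ => hq1 i x)
  -- the loss in one step of the scale induction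
  have hstep : ∀ s < r, ∀ K ≤ 2 * η s, K * (1 / η (s + 1) + M * (b - a) / η (s + 1) ^ 2)
      ≤ 2 * (1 + M * (b - a)) * η r := by
    intro s hs K hK
    have h0 := hη0 (s + 1)
    have h1 : 1 / η (s + 1) + M * (b - a) / η (s + 1) ^ 2
        ≤ (1 + M * (b - a)) / η (s + 1) ^ 2 := by
      rw [add_div]
      gcongr
      rw [sq]
      exact mul_le_of_le_one_right h0.le (hη1 _)
    have h2 : 0 ≤ 1 / η (s + 1) + M * (b - a) / η (s + 1) ^ 2 := by positivity
    calc _ ≤ 2 * η s * ((1 + M * (b - a)) / η (s + 1) ^ 2) :=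
          mul_le_mul hK h1 h2 (by have := hη0 s; positivity)
      _ = 2 * (1 + M * (b - a)) * η (s + 1) := by rw [hη3 s]; field_simp
      _ ≤ _ := by
          gcongr
          exact hηmono _ hs
  -- Downward induction on `s`: passing from `W s` to `W (s + 1)` costs one integration by parts with
  -- the primitive `η s * arctan (φ s / η s)` of `φ (s + 1) * q s`.
  have hint : ∀ s, 1 ≤ s → s ≤ r →
      ∫ x in a..b, W s x ≤ 2 * (1 + M * (b - a)) * η r * (r - s) + (b - a) * (r / c) * η r := by
    intro s hs hsr
    revert hs
    induction hsr using Nat.decreasingInduction with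
    | self =>
      intro _
      have : ∀ x ∈ Set.Icc a b, W r x ≤ r / c * η r := by
        intro x hx
        obtain ⟨j, hj, hjc⟩ : ∃ j ∈ Finset.Icc 1 r, c / r ≤ φ j x ^ 2 := by
          by_contra! hcon
          have h1 : ∑ j ∈ Finset.Icc 1 r, φ j x ^ 2 < ∑ j ∈ Finset.Icc 1 r, c / r :=
            Finset.sum_lt_sum_of_nonempty ⟨1, by simp [hr]⟩ hcon
          have hr' : (r : ℝ) ≠ 0 := by positivity
          simp only [Finset.sum_const, Nat.card_Icc, nsmul_eq_mul, add_tsub_cancel_right] at h1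
          rw [mul_div_cancel₀ _ hr'] at h1
          exact absurd (hlow x hx) (not_le.2 h1)
        have hjr : j ≤ r := (Finset.mem_Icc.1 hj).2
        have hr0 : (0 : ℝ) < r := by exact_mod_cast hr
        refine (hWle r x j hj).trans ?_
        simp only [hq]
        rw [div_le_iff₀ (hpos j x)]
        have h1 : η j ^ 2 ≤ η r := by
          have := hη0 j
          nlinarith [hη1 j, hηmono j hjr]
        have h2 : 1 ≤ r / c * φ j x ^ 2 := by
          calc (1 : ℝ) = r / c * (c / r) := by field_simp
            _ ≤ _ := by gcongr
        have h3 := hη0 r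
        calc η j ^ 2 ≤ η r * 1 := by linarith
          _ ≤ η r * (r / c * φ j x ^ 2) := by gcongr
          _ = r / c * η r * φ j x ^ 2 := by ring
          _ ≤ _ := by gcongr; nlinarith [sq_nonneg (η j)]
      calc ∫ x in a..b, W r x ≤ ∫ _ in a..b, r / c * η r :=
            intervalIntegral.integral_mono_on hab ((hWc r).intervalIntegrable _ _)
              (by simp) this
        _ = _ := by simp; ring
    | of_succ s hsr ih =>
      intro hs
      have ih := ih (by omega)
      have hsplit : ∀ x, W s x ≤ W (s + 1) x + (φ (s + 1) x ^ 2 / (φ (s + 1) x ^ 2 + η (s + 1) ^ 2))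
          • q s x := by
        intro x
        have : W (s + 1) x = W s x * q (s + 1) x := by
          simp only [hW]
          rw [Finset.prod_Icc_succ_top (by omega)]
        rw [hq', this, smul_eq_mul]
        have := hWle s x s (by simp [hs])
        nlinarith [hq1 (s + 1) x]
      have hI := norm_integral_cutoff_smul_le hab (p := φ (s + 1)) (p' := φ (s + 2))
        (G := fun x => η s * Real.arctan (φ s x / η s)) (g := q s) (K := 2 * η s) (M := M)
        (η := η (s + 1)) (hφ _) (hcont _) (hM _ hsr) (fun x => by
          have h := (((hφ s x).div_const (η s)).arctan).const_mul (η s)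
          refine h.congr_deriv ?_
          simp only [hq, smul_eq_mul]
          have := (hη0 s).ne'
          have := (hpos s x).ne'
          field_simp
          ring) (hqc s) (fun x => by
          have h1 := Real.arctan_lt_pi_div_two (φ s x / η s)
          have h2 := Real.neg_pi_div_two_lt_arctan (φ s x / η s)
          have h3 := Real.pi_lt_four
          rw [norm_mul, Real.norm_eq_abs, Real.norm_eq_abs, abs_of_pos (hη0 s), mul_comm]
          refine mul_le_mul_of_nonneg_right ?_ (hη0 s).le
          rw [abs_le]
          constructor <;> linarith) (hη0 _)
      have hI' := (Real.le_norm_self _).trans (hI.trans (hstep s hsr _ le_rfl))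
      have hc1 : Continuous fun x => (φ (s + 1) x ^ 2 / (φ (s + 1) x ^ 2 + η (s + 1) ^ 2)) • q s x := by
        simp_rw [hq']
        have := hqc (s + 1)
        have := hqc s
        fun_prop
      calc ∫ x in a..b, W s x ≤ ∫ x in a..b, (W (s + 1) x +
            (φ (s + 1) x ^ 2 / (φ (s + 1) x ^ 2 + η (s + 1) ^ 2)) • q s x) :=
            intervalIntegral.integral_mono_on hab ((hWc s).intervalIntegrable _ _)
              (((hWc (s + 1)).add hc1).intervalIntegrable _ _) fun x _ => hsplit x
        _ = _ := intervalIntegral.integral_add ((hWc (s + 1)).intervalIntegrable _ _)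
              (hc1.intervalIntegrable _ _)
        _ ≤ _ := add_le_add ih hI'
        _ = _ := by push_cast; ring
  set e : ℝ → ℂ := fun x => Complex.exp (2 * Real.pi * Complex.I * (t * φ 0 x : ℝ)) with he
  have hed : ∀ x, HasDerivAt e (e x * (2 * Real.pi * Complex.I * (t * φ 1 x : ℝ))) x := fun x =>
    (((hφ 0 x).const_mul t).ofReal_comp.const_mul (2 * Real.pi * Complex.I)).cexp
  have hec : Continuous e := continuous_iff_continuousAt.2 fun x => (hed x).continuousAt
  have hen : ∀ x, ‖e x‖ = 1 := fun x => by
    simp only [he]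
    rw [show (2 * Real.pi * Complex.I * (t * φ 0 x : ℝ) : ℂ)
      = ((2 * Real.pi * (t * φ 0 x) : ℝ) : ℂ) * Complex.I by push_cast; ring]
    exact Complex.norm_exp_ofReal_mul_I _
  have hη0t : η 0 = t⁻¹ := by simp [hη, Real.rpow_neg_one]
  have hpi : (Real.pi : ℂ) ≠ 0 := by exact_mod_cast Real.pi_ne_zero
  have htC : (t : ℂ) ≠ 0 := by exact_mod_cast ht0.ne'
  -- The first scale removes the zeros of `φ 1` from the oscillatory integral itself.
  have hI := norm_integral_cutoff_smul_le hab (p := φ 1) (p' := φ 2)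
    (G := fun x => (2 * Real.pi * Complex.I * t)⁻¹ * e x) (g := e) (K := 2 * η 0) (M := M)
    (η := η 1) (hφ _) (hcont _) (hM _ hr) (fun x => by
      have h := (hed x).const_mul ((2 * Real.pi * Complex.I * t : ℂ)⁻¹)
      refine h.congr_deriv ?_
      rw [Complex.real_smul]
      push_cast
      field_simp) hec (fun x => by
      rw [norm_mul, hen, hη0t, mul_one, norm_inv, norm_mul, norm_mul, norm_mul]
      simp only [Complex.norm_I, Complex.norm_real, Complex.norm_ofNat, Real.norm_eq_abs,
        abs_of_pos ht0, abs_of_pos Real.pi_pos]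
      rw [mul_inv]
      apply mul_le_mul_of_nonneg_right _ (by positivity)
      have := Real.pi_gt_three
      rw [inv_le_comm₀ (by positivity) (by norm_num)]
      linarith) (hη0 _)
  have hI' := hI.trans (hstep 0 hr _ le_rfl)
  have hc1 : Continuous fun x => (φ 1 x ^ 2 / (φ 1 x ^ 2 + η 1 ^ 2)) • e x := by
    simp_rw [hq']
    have := hqc 1
    fun_prop
  have hc2 : Continuous fun x => q 1 x • e x := (hqc 1).smul hec
  have hW1 : W 1 = q 1 := by ext x; simp [hW]
  have hfin := hint 1 le_rfl hr
  rw [hW1] at hfin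
  calc ‖∫ x in a..b, e x‖
      = ‖(∫ x in a..b, (φ 1 x ^ 2 / (φ 1 x ^ 2 + η 1 ^ 2)) • e x) + ∫ x in a..b, q 1 x • e x‖ := by
        rw [← intervalIntegral.integral_add (hc1.intervalIntegrable _ _)
          (hc2.intervalIntegrable _ _)]
        congr 2
        ext x
        rw [← add_smul, hq', sub_add_cancel, one_smul]
    _ ≤ _ := norm_add_le _ _
    _ ≤ 2 * (1 + M * (b - a)) * η r + ∫ x in a..b, q 1 x := by
        refine add_le_add hI' ?_
        refine intervalIntegral.norm_integral_le_of_norm_le hab (Eventually.of_forall fun x _ => ?_)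
          ((hqc 1).intervalIntegrable _ _)
        rw [norm_smul, hen, mul_one, Real.norm_eq_abs, abs_of_nonneg (hq0 1 x)]
    _ ≤ _ := add_le_add_right hfin _
    _ = _ := by simp only [hη]; push_cast; ring

/-! ### Phases in a finite-dimensional space of analytic functions -/

lemma pairWeight_of_abs_le_one {δ t : ℝ} (hδ : 0 ≤ δ) (ht : |t| ≤ 1) : pairWeight δ t = 1 := by
  unfold pairWeight
  split_ifs with h
  · rfl
  · exact min_eq_right (Real.one_le_rpow_of_pos_of_le_one_of_nonpos (abs_pos.2 h) ht (by linarith))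

lemma rpow_neg_le_pairWeight {δ t s : ℝ} (hδ : 0 ≤ δ) (hs : 1 ≤ s) (ht : |t| ≤ s) :
    s ^ (-δ) ≤ pairWeight δ t := by
  have h1 : s ^ (-δ) ≤ 1 := Real.rpow_le_one_of_one_le_of_nonpos hs (by linarith)
  unfold pairWeight
  split_ifs with h
  · exact h1
  · exact le_min (Real.rpow_le_rpow_of_nonpos (abs_pos.2 h) ht (by linarith)) h1

lemma exists_iteratedDeriv_ne_zero {F : ℝ → ℝ} (hF : AnalyticOnNhd ℝ F Set.univ)
    (hne : ¬ ∃ c : ℝ, ∀ x, F x = c) (x : ℝ) : ∃ j, 1 ≤ j ∧ iteratedDeriv j F x ≠ 0 := by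
  by_contra! h
  have hD : AnalyticOnNhd ℝ (deriv F) Set.univ := hF.deriv
  have htop : analyticOrderAt (deriv F) x = ⊤ := by
    rw [ENat.eq_top_iff_forall_ge]
    intro n
    rw [natCast_le_analyticOrderAt_iff_iteratedDeriv_eq_zero (hD x trivial)]
    intro i _
    rw [← iteratedDeriv_succ']
    exact h _ (by omega)
  rw [analyticOrderAt_eq_top] at htop
  have hzero := hD.eqOn_zero_of_preconnected_of_eventuallyEq_zero isPreconnected_univ
    (Set.mem_univ x) htop
  have hdiff : Differentiable ℝ F := fun y => (hF y trivial).differentiableAt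
  exact hne ⟨F 0, fun y => is_const_of_deriv_eq_zero hdiff (fun z => hzero (Set.mem_univ z)) y 0⟩

/-- Uniform decay of the oscillatory integrals with phases in a finite-dimensional space of analytic
functions that meets the constants only in `0`. By analyticity, at each point some derivative of a
given non-zero phase does not vanish; compactness of the unit sphere makes the number of derivatives
and the lower bound uniform. -/
lemma exists_norm_integral_exp_le_pairWeight {ι : Type*} [Fintype ι] {g : ι → ℝ → ℝ}
    (hg : ∀ i, AnalyticOnNhd ℝ (g i) Set.univ)
    (hind : ∀ u : ι → ℝ, u ≠ 0 → ¬ ∃ c : ℝ, ∀ x, ∑ i, u i * g i x = c) {a b : ℝ} (hab : a ≤ b) :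
    ∃ δ C : ℝ, 0 < δ ∧ δ ≤ 1 ∧ 0 ≤ C ∧ ∀ (B : ι → ℝ) (j : ι),
      ‖∫ x in a..b, Complex.exp (2 * Real.pi * Complex.I * (∑ i, B i * g i x : ℝ))‖
        ≤ C * pairWeight δ (B j) := by
  set Φ : ℕ → (ι → ℝ) → ℝ → ℝ := fun j u x => ∑ i, u i * iteratedDeriv j (g i) x with hΦ
  have hder : ∀ j i x, HasDerivAt (iteratedDeriv j (g i)) (iteratedDeriv (j + 1) (g i) x) x := by
    intro j i x
    rw [iteratedDeriv_succ]
    have h : ContDiff ℝ ((j + 1 : ℕ) : WithTop ℕ∞) (g i) := (hg i).contDiff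
    exact ((h.differentiable_iteratedDeriv j (by exact_mod_cast Nat.lt_succ_self j)) x).hasDerivAt
  have hΦd : ∀ u j x, HasDerivAt (Φ j u) (Φ (j + 1) u x) x := fun u j x =>
    HasDerivAt.fun_sum fun i _ => (hder j i x).const_mul (u i)
  have hΦ0 : ∀ u x, Φ 0 u x = ∑ i, u i * g i x := fun u x => by simp [hΦ]
  have hiter : ∀ u j, iteratedDeriv j (fun x => ∑ i, u i * g i x) = Φ j u := by
    intro u j
    induction j with
    | zero => ext x; rw [iteratedDeriv_zero, hΦ0]
    | succ j ih => rw [iteratedDeriv_succ, ih]; ext x; exact (hΦd u j x).deriv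
  have hΦc : ∀ j, Continuous fun p : (ι → ℝ) × ℝ => Φ j p.1 p.2 := by
    intro j
    refine continuous_finsetSum _ fun i _ => ?_
    have h1 : Continuous (iteratedDeriv j (g i)) :=
      continuous_iff_continuousAt.2 fun x => (hder j i x).continuousAt
    exact ((continuous_apply i).comp continuous_fst).mul (h1.comp continuous_snd)
  set K : Set ((ι → ℝ) × ℝ) := Metric.sphere 0 1 ×ˢ Set.Icc a b with hK
  have hKc : IsCompact K := (isCompact_sphere _ _).prod isCompact_Icc
  set Q : ℕ → (ι → ℝ) × ℝ → ℝ := fun r p => ∑ j ∈ Finset.Icc 1 r, Φ j p.1 p.2 ^ 2 with hQ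
  have hQc : ∀ r, Continuous (Q r) := fun r => continuous_finsetSum _ fun j _ => (hΦc j).pow 2
  obtain ⟨r, hr⟩ : ∃ r, K ⊆ {p | 0 < Q r p} := by
    refine hKc.elim_directed_cover (fun r => {p | 0 < Q r p})
      (fun r => isOpen_lt continuous_const (hQc r)) ?_ ?_
    · rintro ⟨u, x⟩ hp
      have hu : u ≠ 0 := by
        rintro rfl
        simp [hK] at hp
      have han : AnalyticOnNhd ℝ (fun x => ∑ i, u i * g i x) Set.univ :=
        Finset.analyticOnNhd_fun_sum _ fun i _ => analyticOnNhd_const.mul (hg i)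
      obtain ⟨j, hj, hjne⟩ := exists_iteratedDeriv_ne_zero han (hind u hu) x
      rw [hiter] at hjne
      have hpos : 0 < Q j (u, x) := Finset.sum_pos' (fun i _ => sq_nonneg _)
        ⟨j, Finset.mem_Icc.2 ⟨hj, le_rfl⟩, sq_pos_of_ne_zero hjne⟩
      exact Set.mem_iUnion.2 ⟨j, hpos⟩
    · refine directed_of_isDirected_le fun r s hrs p (hp : 0 < Q r p) => ?_
      exact lt_of_lt_of_le hp <| Finset.sum_le_sum_of_subset_of_nonneg (Finset.Icc_subset_Icc_right hrs)
        fun i _ _ => sq_nonneg _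
  obtain ⟨c, hc, hlow⟩ := hKc.exists_forall_le' (hQc r).continuousOn hr
  have hsumc : Continuous fun p : (ι → ℝ) × ℝ => ∑ j ∈ Finset.range (r + 1), |Φ (j + 1) p.1 p.2| :=
    continuous_finsetSum _ fun j _ => (hΦc (j + 1)).abs
  obtain ⟨M, hM⟩ := hKc.exists_bound_of_continuousOn hsumc.continuousOn
  set C₁ := 2 * (1 + M * (b - a)) * r + (b - a) * (r / c) with hC₁
  have hδ : (0 : ℝ) < (1 / 3) ^ r := by positivity
  have hL : 0 ≤ b - a := sub_nonneg.2 hab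
  refine ⟨(1 / 3) ^ r, |C₁| + (b - a), hδ, pow_le_one₀ (by norm_num) (by norm_num), by positivity,
    fun B j => ?_⟩
  have hBj : |B j| ≤ ‖B‖ := norm_le_pi_norm B j
  rcases le_total ‖B‖ 1 with hB | hB
  · rw [pairWeight_of_abs_le_one hδ.le (hBj.trans hB), mul_one]
    have : ‖∫ x in a..b, Complex.exp (2 * Real.pi * Complex.I * (∑ i, B i * g i x : ℝ))‖
        ≤ 1 * |b - a| := by
      refine intervalIntegral.norm_integral_le_of_norm_le_const fun x _ => le_of_eq ?_
      rw [show (2 * Real.pi * Complex.I * (∑ i, B i * g i x : ℝ) : ℂ)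
        = ((2 * Real.pi * (∑ i, B i * g i x) : ℝ) : ℂ) * Complex.I by push_cast; ring]
      exact Complex.norm_exp_ofReal_mul_I _
    rw [abs_of_nonneg hL, one_mul] at this
    linarith [abs_nonneg C₁]
  · have hB0 : ‖B‖ ≠ 0 := by linarith
    set u : ι → ℝ := ‖B‖⁻¹ • B with hu
    have hu1 : ‖u‖ = 1 := by rw [hu, norm_smul, norm_inv, norm_norm, inv_mul_cancel₀ hB0]
    have hmem : ∀ x ∈ Set.Icc a b, (u, x) ∈ K := fun x hx => ⟨by simp [hu1], hx⟩
    have key := norm_integral_exp_le_rpow hab (φ := fun j => Φ j u) (hΦd u) hc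
      (M := M) (fun j hj x hx => by
        refine le_trans ?_ ((Real.le_norm_self _).trans (hM (u, x) (hmem x hx)))
        exact Finset.single_le_sum (f := fun j => |Φ (j + 1) u x|) (fun i _ => abs_nonneg _)
          (Finset.mem_range.2 (Nat.lt_succ_of_le hj)))
      (fun x hx => hlow (u, x) (hmem x hx)) hB
    have hphase : ∀ x, ‖B‖ * Φ 0 u x = ∑ i, B i * g i x := by
      intro x
      rw [hΦ0, Finset.mul_sum]
      refine Finset.sum_congr rfl fun i _ => ?_
      simp only [hu, Pi.smul_apply, smul_eq_mul]
      field_simp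
    simp only [hphase] at key
    refine key.trans ?_
    exact mul_le_mul (by linarith [le_abs_self C₁]) (rpow_neg_le_pairWeight hδ.le hB hBj)
      (by positivity) (by positivity)

/-! ### Almost everywhere convergence of averages -/

lemma ae_tendsto_zero_of_summable_integral {α : Type*} [MeasurableSpace α] {μ : Measure α}
    {f : ℕ → α → ℝ} (hf0 : ∀ q x, 0 ≤ f q x) (hfi : ∀ q, Integrable (f q) μ)
    (hs : Summable fun q => ∫ x, f q x ∂μ) : ∀ᵐ x ∂μ, Tendsto (fun q => f q x) atTop (𝓝 0) := by
  have hm : ∀ q, AEMeasurable (fun x => ENNReal.ofReal (f q x)) μ := fun q =>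
    (hfi q).aestronglyMeasurable.aemeasurable.ennreal_ofReal
  have h1 : ∫⁻ x, ∑' q, ENNReal.ofReal (f q x) ∂μ ≠ ⊤ := by
    rw [lintegral_tsum hm]
    simp_rw [← ofReal_integral_eq_lintegral_ofReal (hfi _) (Eventually.of_forall (hf0 _))]
    rw [← ENNReal.ofReal_tsum_of_nonneg (fun q => integral_nonneg (hf0 q)) hs]
    exact ENNReal.ofReal_ne_top
  filter_upwards [ae_lt_top' (AEMeasurable.tsum hm) h1] with x hx
  have h2 := ENNReal.tendsto_atTop_zero_of_tsum_ne_top hx.ne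
  have h3 := (ENNReal.tendsto_toReal ENNReal.zero_ne_top).comp h2
  simpa [Function.comp_def, ENNReal.toReal_ofReal (hf0 _ x)] using h3

/-- Averages of a bounded sequence converge to `0` as soon as they do along the sequences
`⌊c ^ q⌋`, for `c > 1` arbitrarily close to `1`. The monotone sequences `N + Re S N` and
`N + Im S N` reduce this to a statement about monotone real sequences. -/
lemma tendsto_average_zero_of_floor_pow {E : ℕ → ℂ} (hE : ∀ n, ‖E n‖ ≤ 1) {c : ℕ → ℝ}
    (hc : ∀ j, 1 < c j) (hclim : Tendsto c atTop (𝓝 1))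
    (h : ∀ j, Tendsto (fun q : ℕ => (1 / (⌊c j ^ q⌋₊ : ℂ)) * ∑ n ∈ Finset.Icc 1 ⌊c j ^ q⌋₊, E n)
      atTop (𝓝 0)) :
    Tendsto (fun N : ℕ => (1 / (N : ℂ)) * ∑ n ∈ Finset.Icc 1 N, E n) atTop (𝓝 0) := by
  have key : ∀ L : ℂ →L[ℝ] ℝ, (∀ z, |L z| ≤ ‖z‖) →
      Tendsto (fun N : ℕ => L ((1 / (N : ℂ)) * ∑ n ∈ Finset.Icc 1 N, E n)) atTop (𝓝 0) := by
    intro L hL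
    set u : ℕ → ℝ := fun N => ∑ n ∈ Finset.Icc 1 N, (1 + L (E n)) with hu
    have hL' : ∀ N : ℕ, N ≠ 0 → L ((1 / (N : ℂ)) * ∑ n ∈ Finset.Icc 1 N, E n) = u N / N - 1 := by
      intro N hN
      have hN' : (N : ℝ) ≠ 0 := by exact_mod_cast hN
      rw [show (1 / (N : ℂ)) * ∑ n ∈ Finset.Icc 1 N, E n
        = (1 / (N : ℝ)) • ∑ n ∈ Finset.Icc 1 N, E n by rw [Complex.real_smul]; push_cast; rfl]
      rw [map_smul, map_sum, hu]
      simp only [Finset.sum_add_distrib, Finset.sum_const, Nat.card_Icc, add_tsub_cancel_right,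
        nsmul_eq_mul, mul_one, smul_eq_mul]
      field_simp
      ring
    have hmono : Monotone u := monotone_nat_of_le_succ fun N => by
      simp only [hu]
      rw [Finset.sum_Icc_succ_top (by omega)]
      have := (abs_le.1 ((hL (E (N + 1))).trans (hE _))).1
      linarith
    have hsub : ∀ j, Tendsto (fun q : ℕ => u ⌊c j ^ q⌋₊ / ⌊c j ^ q⌋₊) atTop (𝓝 1) := by
      intro j
      have h1 := ((L.continuous.tendsto 0).comp (h j)).add_const 1
      rw [map_zero, zero_add] at h1
      refine h1.congr fun q => ?_
      have hq : ⌊c j ^ q⌋₊ ≠ 0 := (Nat.floor_pos.2 (one_le_pow₀ (hc j).le)).ne'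
      simp only [Function.comp_apply]
      rw [hL' _ hq]
      ring
    have hlim := (tendsto_div_of_monotone_of_tendsto_div_floor_pow u 1 hmono c hc hclim
      hsub).sub_const 1
    rw [sub_self] at hlim
    refine hlim.congr' ?_
    filter_upwards [eventually_ne_atTop 0] with N hN
    exact (hL' N hN).symm
  have h1 := key Complex.reCLM fun z => Complex.abs_re_le_norm z
  have h2 := key Complex.imCLM fun z => Complex.abs_im_le_norm z
  have h3 := (Complex.continuous_ofReal.tendsto 0).comp h1
  have h4 := ((Complex.continuous_ofReal.tendsto 0).comp h2).mul_const Complex.I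
  have h5 := h3.add h4
  simp only [Complex.ofReal_zero, zero_mul, add_zero] at h5
  refine h5.congr fun N => ?_
  exact Complex.re_add_im _

lemma sum_sum_Icc_of_symm {w : ℕ → ℕ → ℝ} (hw : ∀ m n, w m n = w n m) (hd : ∀ n, w n n = 1)
    (N : ℕ) : ∑ n ∈ Finset.Icc 1 N, ∑ m ∈ Finset.Icc 1 N, w n m
      = N + 2 * ∑ n ∈ Finset.Icc 1 N, ∑ m ∈ Finset.Ico 1 n, w n m := by
  induction N with
  | zero => simp
  | succ N ih =>
    have hI : Finset.Ico 1 (N + 1) = Finset.Icc 1 N := by ext; simp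
    rw [Finset.sum_Icc_succ_top (by omega), Finset.sum_Icc_succ_top (by omega),
      Finset.sum_Icc_succ_top (by omega), hI]
    simp_rw [Finset.sum_Icc_succ_top (show 1 ≤ N + 1 by omega), Finset.sum_add_distrib]
    rw [ih, hd, Finset.sum_congr rfl fun n _ => hw n (N + 1)]
    push_cast
    ring

/-- The mean square over `[a, b]` of a sum of functions is controlled by the correlations. -/
lemma integral_norm_sum_sq_le {a b : ℝ} {E : ℕ → ℝ → ℂ} (hE : ∀ n, Continuous (E n))
    {w : ℕ → ℕ → ℝ}
    (hw : ∀ n m, ‖∫ x in a..b, E n x * (starRingEnd ℂ) (E m x)‖ ≤ w n m) (s : Finset ℕ) :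
    ∫ x in a..b, ‖∑ n ∈ s, E n x‖ ^ 2 ≤ ∑ n ∈ s, ∑ m ∈ s, w n m := by
  have hc : ∀ n m, Continuous fun x => E n x * (starRingEnd ℂ) (E m x) := fun n m =>
    (hE n).mul (Complex.continuous_conj.comp (hE m))
  have h1 : ∀ x, ((‖∑ n ∈ s, E n x‖ ^ 2 : ℝ) : ℂ)
      = ∑ n ∈ s, ∑ m ∈ s, E n x * (starRingEnd ℂ) (E m x) := by
    intro x
    push_cast
    rw [← Complex.mul_conj', map_sum, Finset.sum_mul_sum]
  have h2 : ((∫ x in a..b, ‖∑ n ∈ s, E n x‖ ^ 2 : ℝ) : ℂ)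
      = ∑ n ∈ s, ∑ m ∈ s, ∫ x in a..b, E n x * (starRingEnd ℂ) (E m x) := by
    rw [← intervalIntegral.integral_ofReal]
    simp_rw [h1]
    rw [intervalIntegral.integral_finsetSum fun n _ =>
      (continuous_finsetSum s fun m _ => hc n m).intervalIntegrable _ _]
    refine Finset.sum_congr rfl fun n _ => ?_
    rw [intervalIntegral.integral_finsetSum fun m _ => (hc n m).intervalIntegrable _ _]
  refine (Real.le_norm_self _).trans ?_
  rw [← Complex.norm_real, h2]
  exact (norm_sum_le _ _).trans (Finset.sum_le_sum fun n _ =>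
    (norm_sum_le _ _).trans (Finset.sum_le_sum fun m _ => hw n m))

lemma summable_div_log_floor_pow_rpow {c ε : ℝ} (hc : 1 < c) (hε : 0 < ε) (D : ℝ) :
    Summable fun q : ℕ => D / Real.log ⌊c ^ q⌋₊ ^ (1 + ε) := by
  have hl : 0 < Real.log c := Real.log_pos hc
  have h1 : Summable fun q : ℕ => |D| * (Real.log c / 2) ^ (-(1 + ε)) * (1 / (q : ℝ) ^ (1 + ε)) :=
    (Real.summable_one_div_nat_rpow.2 (by linarith)).mul_left _
  refine Summable.of_norm_bounded_eventually_nat h1 ?_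
  obtain ⟨Q, hQ⟩ := exists_nat_gt (2 * Real.log 2 / Real.log c)
  filter_upwards [eventually_ge_atTop (Q + 1)] with q hq
  have hq0 : (0 : ℝ) < q := by exact_mod_cast (by omega : 0 < q)
  have hqQ : 2 * Real.log 2 / Real.log c < q := hQ.trans (by exact_mod_cast hq)
  rw [div_lt_iff₀ hl] at hqQ
  have hfl : c ^ q / 2 ≤ (⌊c ^ q⌋₊ : ℝ) := by
    have h2 := Nat.lt_floor_add_one (c ^ q)
    have h3 : (1 : ℝ) ≤ ⌊c ^ q⌋₊ := by
      exact_mod_cast Nat.floor_pos.2 (one_le_pow₀ hc.le)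
    linarith
  have hlog : Real.log c / 2 * q ≤ Real.log ⌊c ^ q⌋₊ := by
    have h2 := Real.log_le_log (by positivity) hfl
    rw [Real.log_div (by positivity) (by norm_num), Real.log_pow] at h2
    linarith
  have hpos : 0 < Real.log c / 2 * q := by positivity
  have hmono : (Real.log c / 2 * q) ^ (1 + ε) ≤ Real.log ⌊c ^ q⌋₊ ^ (1 + ε) :=
    Real.rpow_le_rpow hpos.le hlog (by linarith)
  have hp : 0 < (Real.log c / 2 * q) ^ (1 + ε) := Real.rpow_pos_of_pos hpos _
  rw [Real.norm_eq_abs, abs_div, abs_of_pos (hp.trans_le hmono)]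
  calc |D| / Real.log ⌊c ^ q⌋₊ ^ (1 + ε) ≤ |D| / (Real.log c / 2 * q) ^ (1 + ε) := by gcongr
    _ = _ := by
      rw [Real.mul_rpow (by positivity) hq0.le, Real.rpow_neg (by positivity)]
      field_simp

/-- Unimodular functions whose correlations are controlled by the differences of a scattered
sequence have averages that vanish almost everywhere: along `N = ⌊c ^ q⌋` the mean squares of the
averages are `O(1 / q ^ (1 + ε))`, hence summable. -/
lemma ae_tendsto_average_zero {a b : ℝ} (hab : a ≤ b) {E : ℕ → ℝ → ℂ} (hE : ∀ n, Continuous (E n))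
    (hE1 : ∀ n x, ‖E n x‖ = 1) {δ C : ℝ} (hC : 0 ≤ C) {s : ℕ → ℝ}
    (hs : IsDeltaScattered δ s)
    (hcor : ∀ n m, ‖∫ x in a..b, E n x * (starRingEnd ℂ) (E m x)‖ ≤ C * pairWeight δ (s n - s m)) :
    ∀ᵐ x ∂(volume.restrict (Set.Ioc a b)),
      Tendsto (fun N : ℕ => (1 / (N : ℂ)) * ∑ n ∈ Finset.Icc 1 N, E n x) atTop (𝓝 0) := by
  obtain ⟨ε, hε, hev⟩ := hs
  set f : ℕ → ℝ → ℝ := fun N x => ‖(1 / (N : ℂ)) * ∑ n ∈ Finset.Icc 1 N, E n x‖ ^ 2 with hf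
  have hfc : ∀ N, Continuous (f N) := fun N =>
    (continuous_const.mul (continuous_finsetSum _ fun n _ => hE n)).norm.pow 2
  have hbound : ∀ᶠ N : ℕ in atTop, ∫ x in a..b, f N x ≤ 3 * C / Real.log N ^ (1 + ε) := by
    have hlittle := (isLittleO_log_rpow_rpow_atTop (1 + ε) one_pos).def one_pos
    filter_upwards [hev, tendsto_natCast_atTop_atTop.eventually hlittle, eventually_ge_atTop 2]
      with N hN hlog hN2
    have hN0 : (0 : ℝ) < N := by positivity
    have hlogpos : 0 < Real.log N := Real.log_pos (by exact_mod_cast hN2)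
    have hlogr : 0 < Real.log N ^ (1 + ε) := Real.rpow_pos_of_pos hlogpos _
    simp only [Real.rpow_one, one_mul, Real.norm_eq_abs, abs_of_pos hlogr, abs_of_pos hN0] at hlog
    have h1 := integral_norm_sum_sq_le hE hcor (Finset.Icc 1 N)
    have hsymm : ∀ m n, pairWeight δ (s m - s n) = pairWeight δ (s n - s m) := by
      intro m n
      simp only [pairWeight, sub_eq_zero, abs_sub_comm (s m), eq_comm (a := s m)]
    have h2 := sum_sum_Icc_of_symm (w := fun n m => pairWeight δ (s n - s m))
      (fun m n => hsymm m n) (fun n => by simp [pairWeight]) N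
    simp_rw [← Finset.mul_sum] at h1
    rw [h2] at h1
    have h3 : ∀ x, f N x = (1 / (N : ℝ) ^ 2) * ‖∑ n ∈ Finset.Icc 1 N, E n x‖ ^ 2 := by
      intro x
      simp only [hf]
      rw [norm_mul, mul_pow]
      simp
    simp_rw [h3]
    rw [intervalIntegral.integral_const_mul]
    calc _ ≤ 1 / (N : ℝ) ^ 2 * (C * (N + 2 * ∑ n ∈ Finset.Icc 1 N, ∑ m ∈ Finset.Ico 1 n,
          pairWeight δ (s n - s m))) := by gcongr
      _ = C * (1 / N + 2 * (1 / (N : ℝ) ^ 2 * ∑ n ∈ Finset.Icc 1 N, ∑ m ∈ Finset.Ico 1 n,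
          pairWeight δ (s n - s m))) := by field_simp
      _ ≤ C * (1 / Real.log N ^ (1 + ε) + 2 * (1 / Real.log N ^ (1 + ε))) := by gcongr
      _ = _ := by ring
  set c : ℕ → ℝ := fun j => 1 + 1 / ((j : ℝ) + 1) with hc
  have hc1 : ∀ j, 1 < c j := fun j => by
    have : (0 : ℝ) < 1 / ((j : ℝ) + 1) := by positivity
    simp only [hc]; linarith
  have hclim : Tendsto c atTop (𝓝 1) := by
    simpa [hc] using (tendsto_one_div_add_atTop_nhds_zero_nat (𝕜 := ℝ)).const_add 1
  have hsub : ∀ j, ∀ᵐ x ∂(volume.restrict (Set.Ioc a b)),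
      Tendsto (fun q : ℕ => f ⌊c j ^ q⌋₊ x) atTop (𝓝 0) := by
    intro j
    refine ae_tendsto_zero_of_summable_integral (fun q x => by positivity)
      (fun q => ((hfc _).integrableOn_Icc).mono_set Set.Ioc_subset_Icc_self) ?_
    refine Summable.of_norm_bounded_eventually_nat
      (summable_div_log_floor_pow_rpow (hc1 j) hε (3 * C)) ?_
    have ht : Tendsto (fun q : ℕ => ⌊c j ^ q⌋₊) atTop atTop :=
      (tendsto_nat_floor_atTop (α := ℝ)).comp (tendsto_pow_atTop_atTop_of_one_lt (hc1 j))
    filter_upwards [ht.eventually hbound] with q hq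
    rw [Real.norm_eq_abs, abs_of_nonneg (integral_nonneg fun x => by positivity),
      ← intervalIntegral.integral_of_le hab]
    exact hq
  rw [← ae_all_iff] at hsub
  filter_upwards [hsub] with x hx
  refine tendsto_average_zero_of_floor_pow (fun n => (hE1 n x).le) hc1 hclim fun j => ?_
  rw [tendsto_zero_iff_norm_tendsto_zero]
  have := (hx j).sqrt
  simpa only [hf, Real.sqrt_sq (norm_nonneg _), Real.sqrt_zero] using this

/-! ### Weyl's criterion -/

instance isProbabilityMeasure_volume_unitAddCircle :
    IsProbabilityMeasure (volume : Measure UnitAddCircle) :=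
  ⟨UnitAddCircle.measure_univ⟩

lemma integral_fourier_eq_zero {n : ℤ} (hn : n ≠ 0) :
    ∫ t : UnitAddCircle, fourier n t = 0 :=
  integral_eq_zero_of_add_right_eq_neg (fourier_add_half_inv_index hn one_pos)

lemma integral_mFourier_eq_zero {ι : Type*} [Fintype ι] {n : ι → ℤ} (hn : n ≠ 0) :
    ∫ t : ι → UnitAddCircle, UnitAddTorus.mFourier n t = 0 := by
  obtain ⟨i, hi⟩ := Function.ne_iff.1 hn
  have h : ∫ t : ι → UnitAddCircle, ∏ i, (fourier (n i) (t i) : ℂ)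
      = ∏ i, ∫ t : UnitAddCircle, (fourier (n i) t : ℂ) :=
    integral_fintype_prod_volume_eq_prod fun i (t : UnitAddCircle) => (fourier (n i) t : ℂ)
  refine h.trans (Finset.prod_eq_zero (Finset.mem_univ i) (integral_fourier_eq_zero hi))

lemma mFourier_coe {ι : Type*} [Fintype ι] (n : ι → ℤ) (x : ι → ℝ) :
    UnitAddTorus.mFourier n (fun i => (x i : UnitAddCircle))
      = Complex.exp (2 * Real.pi * Complex.I * (∑ i, n i * x i : ℝ)) := by
  simp only [UnitAddTorus.mFourier, ContinuousMap.coe_mk, fourier_coe_apply]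
  rw [← Complex.exp_sum]
  congr 1
  push_cast
  rw [Finset.mul_sum]
  exact Finset.sum_congr rfl fun i _ => by ring

/-- The averages along `y` of continuous functions on the torus converge to the integral, once they
do so for the characters, whose span is dense. -/
lemma tendsto_average_of_mFourier {ι : Type*} [Fintype ι] {y : ℕ → ι → UnitAddCircle}
    (h : ∀ n : ι → ℤ, n ≠ 0 → Tendsto (fun N : ℕ =>
      (1 / (N : ℂ)) * ∑ j ∈ Finset.Icc 1 N, UnitAddTorus.mFourier n (y j)) atTop (𝓝 0))
    (F : C(UnitAddTorus ι, ℂ)) :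
    Tendsto (fun N : ℕ => (1 / (N : ℂ)) * ∑ j ∈ Finset.Icc 1 N, F (y j)) atTop
      (𝓝 (∫ t : ι → UnitAddCircle, F t)) := by
  have hint : ∀ G : C(UnitAddTorus ι, ℂ), Integrable (fun t : ι → UnitAddCircle => G t) :=
    fun G => Integrable.of_bound G.continuous.aestronglyMeasurable ‖G‖
      (Eventually.of_forall G.norm_coe_le_norm)
  have hspan : ∀ G ∈ Submodule.span ℂ (Set.range (UnitAddTorus.mFourier (d := ι))),
      Tendsto (fun N : ℕ => (1 / (N : ℂ)) * ∑ j ∈ Finset.Icc 1 N, G (y j)) atTop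
        (𝓝 (∫ t : ι → UnitAddCircle, G t)) := by
    intro G hG
    induction hG using Submodule.span_induction with
    | mem G hG =>
      obtain ⟨n, rfl⟩ := hG
      by_cases hn : n = 0
      · subst hn
        simp only [UnitAddTorus.mFourier_zero, ContinuousMap.one_apply, Finset.sum_const,
          Nat.card_Icc, add_tsub_cancel_right, nsmul_eq_mul, mul_one, integral_const,
          probReal_univ, one_smul]
        refine tendsto_const_nhds.congr' ?_
        filter_upwards [eventually_ne_atTop 0] with N hN
        have : (N : ℂ) ≠ 0 := by exact_mod_cast hN
        field_simp
      · rw [integral_mFourier_eq_zero hn]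
        exact h n hn
    | zero => simp
    | add G₁ G₂ _ _ h₁ h₂ =>
      simp only [ContinuousMap.add_apply]
      rw [integral_add (hint G₁) (hint G₂)]
      refine (h₁.add h₂).congr fun N => ?_
      rw [Finset.sum_add_distrib, mul_add]
    | smul c G _ hG =>
      simp only [ContinuousMap.smul_apply, smul_eq_mul]
      rw [integral_const_mul]
      refine (hG.const_mul c).congr fun N => ?_
      rw [← Finset.mul_sum]
      ring
  rw [Metric.tendsto_atTop]
  intro ε hε
  have hF : F ∈ closure (Submodule.span ℂ (Set.range (UnitAddTorus.mFourier (d := ι))) :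
      Set C(UnitAddTorus ι, ℂ)) := by
    rw [← Submodule.topologicalClosure_coe, UnitAddTorus.span_mFourier_closure_eq_top]
    trivial
  obtain ⟨G, hG, hFG⟩ := Metric.mem_closure_iff.1 hF (ε / 3) (by positivity)
  rw [dist_eq_norm] at hFG
  obtain ⟨N₀, hN₀⟩ := Metric.tendsto_atTop.1 (hspan G hG) (ε / 3) (by positivity)
  refine ⟨N₀, fun N hN => ?_⟩
  have h1 := hN₀ N hN
  rw [dist_eq_norm] at h1 ⊢
  have h2 : ‖(1 / (N : ℂ)) * ∑ j ∈ Finset.Icc 1 N, (F - G) (y j)‖ ≤ ‖F - G‖ := by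
    rcases Nat.eq_zero_or_pos N with rfl | hN0
    · simp
    have hN' : (0 : ℝ) < N := by exact_mod_cast hN0
    rw [norm_mul, norm_div, norm_one, Complex.norm_natCast, one_div, inv_mul_le_iff₀ hN']
    calc _ ≤ ∑ j ∈ Finset.Icc 1 N, ‖F - G‖ :=
          norm_sum_le_of_le _ fun j _ => (F - G).norm_coe_le_norm (y j)
      _ = _ := by simp
  have h3 : ‖∫ t : ι → UnitAddCircle, (F - G) t‖ ≤ ‖F - G‖ := by
    have := norm_integral_le_of_norm_le_const (μ := (volume : Measure (ι → UnitAddCircle)))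
      (Eventually.of_forall (F - G).norm_coe_le_norm)
    simpa using this
  have e : (1 / (N : ℂ)) * ∑ j ∈ Finset.Icc 1 N, F (y j) - ∫ t : ι → UnitAddCircle, F t
      = (1 / (N : ℂ)) * ∑ j ∈ Finset.Icc 1 N, (F - G) (y j)
        + ((1 / (N : ℂ)) * ∑ j ∈ Finset.Icc 1 N, G (y j) - ∫ t : ι → UnitAddCircle, G t)
        - ∫ t : ι → UnitAddCircle, (F - G) t := by
    simp only [ContinuousMap.sub_apply]
    rw [integral_sub (hint F) (hint G), Finset.sum_sub_distrib]
    ring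
  rw [e]
  calc _ ≤ ‖(1 / (N : ℂ)) * ∑ j ∈ Finset.Icc 1 N, (F - G) (y j)‖
        + ‖(1 / (N : ℂ)) * ∑ j ∈ Finset.Icc 1 N, G (y j) - ∫ t : ι → UnitAddCircle, G t‖
        + ‖∫ t : ι → UnitAddCircle, (F - G) t‖ :=
        (norm_sub_le _ _).trans (add_le_add_left (norm_add_le _ _) _)
    _ < ε := by linarith

/-- The points of the circle `ℝ / ℤ` whose representative in `[0, 1)` lies in `I`. -/
def circleSet (I : Set ℝ) : Set UnitAddCircle :=
  {t | (AddCircle.equivIco 1 0 t : ℝ) ∈ I}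

lemma coe_mem_circleSet {I : Set ℝ} {x : ℝ} : (x : UnitAddCircle) ∈ circleSet I ↔ Int.fract x ∈ I := by
  simp only [circleSet, Set.mem_ofPred_eq]
  rw [AddCircle.coe_equivIco_mk_apply]
  simp

lemma measurableSet_circleSet {I : Set ℝ} (hI : I.OrdConnected) : MeasurableSet (circleSet I) :=
  (measurable_subtype_coe.comp (AddCircle.measurableEquivIco 1 0).measurable) hI.measurableSet

lemma fract_of_mem_Ioo {x : ℝ} (hx : x ∈ Set.Ioo (0 : ℝ) 1) : Int.fract x = x :=
  Int.fract_eq_self.2 ⟨hx.1.le, hx.2⟩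

lemma volume_circleSet {I : Set ℝ} (hI : I.OrdConnected) (hI1 : I ⊆ Set.Icc 0 1) :
    volume (circleSet I) = volume I := by
  have hm := measurableSet_circleSet hI
  have hmp := UnitAddCircle.measurePreserving_mk 0
  rw [← hmp.measure_preimage hm.nullMeasurableSet,
    Measure.restrict_apply (hmp.measurable hm), zero_add]
  refine measure_congr ?_
  filter_upwards [compl_mem_ae_iff.2 (measure_singleton (0 : ℝ)),
    compl_mem_ae_iff.2 (measure_singleton (1 : ℝ))] with x h0 h1
  refine propext ⟨fun hx => ?_, fun hx => ?_⟩
  · have hx1 : x ∈ Set.Ioo (0 : ℝ) 1 := ⟨hx.2.1, lt_of_le_of_ne hx.2.2 h1⟩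
    have := coe_mem_circleSet.1 hx.1
    rwa [fract_of_mem_Ioo hx1] at this
  · have hx1 := hI1 hx
    have hx2 : x ∈ Set.Ioo (0 : ℝ) 1 :=
      ⟨lt_of_le_of_ne hx1.1 (Ne.symm h0), lt_of_le_of_ne hx1.2 h1⟩
    refine ⟨coe_mem_circleSet.2 ?_, Set.Ioo_subset_Ioc_self hx2⟩
    rwa [fract_of_mem_Ioo hx2]

lemma volume_frontier_circleSet {I : Set ℝ} (hI : I.OrdConnected) :
    volume (frontier (circleSet I)) = 0 := by
  have hmp := UnitAddCircle.measurePreserving_mk 0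
  rw [← hmp.measure_preimage isClosed_frontier.measurableSet.nullMeasurableSet,
    Measure.restrict_apply (hmp.measurable isClosed_frontier.measurableSet), zero_add]
  have hpre : ((↑) : ℝ → UnitAddCircle) ⁻¹' frontier (circleSet I)
      = frontier {x | Int.fract x ∈ I} := by
    have := QuotientAddGroup.isOpenMap_coe.preimage_frontier_eq_frontier_preimage
      (AddCircle.continuous_mk' (1 : ℝ)) (circleSet I)
    refine this.trans ?_
    congr 1
    ext x
    exact coe_mem_circleSet
  rw [hpre]
  refine measure_mono_null (t := frontier I ∪ {1}) ?_
    (measure_union_null (hI.convex.addHaar_frontier volume) (measure_singleton 1))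
  rintro x ⟨hx, hx0, hx1⟩
  rcases hx1.eq_or_lt with h | h
  · exact Or.inr h
  left
  have hsets : {x | Int.fract x ∈ I} ∩ Set.Ioo (0 : ℝ) 1 = I ∩ Set.Ioo 0 1 := by
    ext z
    refine and_congr_left fun hz => ?_
    rw [Set.mem_ofPred_eq, fract_of_mem_Ioo hz]
  have h1 : x ∈ frontier {x | Int.fract x ∈ I} ∩ Set.Ioo 0 1 := ⟨hx, hx0, h⟩
  rw [← frontier_inter_open_inter isOpen_Ioo, hsets, frontier_inter_open_inter isOpen_Ioo] at h1
  exact h1.1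

lemma volume_frontier_pi_eq_zero {ι : Type*} [Fintype ι] {B : ι → Set UnitAddCircle}
    (hB : ∀ i, volume (frontier (B i)) = 0) : volume (frontier (Set.univ.pi B)) = 0 := by
  have hsub : frontier (Set.univ.pi B) ⊆ ⋃ i, Function.eval i ⁻¹' frontier (B i) := by
    rintro t ⟨h1, h2⟩
    rw [closure_pi_set] at h1
    rw [interior_pi_set Set.finite_univ] at h2
    simp only [Set.mem_pi, Set.mem_univ, true_implies, not_forall] at h1 h2
    obtain ⟨i, hi⟩ := h2
    exact Set.mem_iUnion.2 ⟨i, h1 i, hi⟩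
  refine measure_mono_null hsub (measure_iUnion_null fun i => ?_)
  exact Measure.pi_eval_preimage_null (fun _ => volume) (hB i)

/-- The uniform probability measure on the points `y 1, …, y (N + 1)`, with multiplicity. -/
noncomputable def empiricalMeasure {α : Type*} [MeasurableSpace α] (y : ℕ → α) (N : ℕ) :
    Measure α :=
  ((N + 1 : ℕ) : ENNReal)⁻¹ • ∑ n ∈ Finset.Icc 1 (N + 1), Measure.dirac (y n)

instance isProbabilityMeasure_empiricalMeasure {α : Type*} [MeasurableSpace α] (y : ℕ → α) (N : ℕ) :
    IsProbabilityMeasure (empiricalMeasure y N) := by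
  refine ⟨?_⟩
  simp only [empiricalMeasure, Measure.smul_apply, Measure.finsetSum_apply, measure_univ,
    Finset.sum_const, Nat.card_Icc, add_tsub_cancel_right, nsmul_eq_mul, mul_one, smul_eq_mul]
  exact ENNReal.inv_mul_cancel (by simp) (ENNReal.natCast_ne_top _)

open scoped Classical in
lemma empiricalMeasure_toReal {α : Type*} [MeasurableSpace α] (y : ℕ → α) (N : ℕ) {B : Set α}
    (hB : MeasurableSet B) : (empiricalMeasure y N B).toReal
      = 1 / ((N + 1 : ℕ) : ℝ) * (((Finset.Icc 1 (N + 1)).filter fun n => y n ∈ B).card : ℝ) := by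
  simp only [empiricalMeasure, Measure.smul_apply, Measure.finsetSum_apply, smul_eq_mul,
    Measure.dirac_apply' _ hB, Set.indicator_apply, Pi.one_apply, Finset.sum_boole,
    ENNReal.toReal_mul, ENNReal.toReal_inv, ENNReal.toReal_natCast, one_div]

/-- Weyl's criterion: decay of all non-trivial exponential averages implies uniform distribution in
boxes. The empirical measures on the torus converge weakly to Haar measure, and boxes have null
frontier. -/
lemma isUniformlyDistributedModOne_of_tendsto_exp {k : ℕ} {x : ℕ → Fin k → ℝ}
    (h : ∀ v : Fin k → ℤ, v ≠ 0 → Tendsto (fun N : ℕ => (1 / (N : ℂ)) * ∑ n ∈ Finset.Icc 1 N,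
      Complex.exp (2 * Real.pi * Complex.I * (∑ i, v i * x n i : ℝ))) atTop (𝓝 0)) :
    IsUniformlyDistributedModOne x := by
  classical
  intro I hI
  set y : ℕ → Fin k → UnitAddCircle := fun n i => (x n i : UnitAddCircle) with hy
  have hav := tendsto_average_of_mFourier (y := y) (fun v hv => by
    simp only [hy, mFourier_coe]; exact h v hv)
  set μ : ProbabilityMeasure (Fin k → UnitAddCircle) := ⟨volume, inferInstance⟩ with hμ
  set ν : ℕ → ProbabilityMeasure (Fin k → UnitAddCircle) :=
    fun N => ⟨empiricalMeasure y N, inferInstance⟩ with hν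
  have hweak : Tendsto ν atTop (𝓝 μ) := by
    rw [ProbabilityMeasure.tendsto_iff_forall_integral_rclike_tendsto ℂ]
    intro F
    have h1 := (tendsto_add_atTop_iff_nat 1).2 (hav F.toContinuousMap)
    refine h1.congr fun N => ?_
    simp only [hν, empiricalMeasure, ProbabilityMeasure.coe_mk]
    rw [integral_smul_measure, integral_finsetSum_measure fun n _ => integrable_dirac (by simp)]
    have hcast : ((N : ENNReal) + 1).toReal = N + 1 := by
      rw [ENNReal.toReal_add (ENNReal.natCast_ne_top N) ENNReal.one_ne_top]
      simp
    simp [integral_dirac, Complex.real_smul, hcast]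
  set B : Fin k → Set UnitAddCircle := fun i => circleSet (I i) with hB
  have hBm : MeasurableSet (Set.univ.pi B) :=
    MeasurableSet.univ_pi fun i => measurableSet_circleSet (hI i).1
  have hport := ProbabilityMeasure.tendsto_measure_of_null_frontier_of_tendsto' hweak
    (E := Set.univ.pi B) (volume_frontier_pi_eq_zero fun i => volume_frontier_circleSet (hI i).1)
  have hreal := (ENNReal.tendsto_toReal (measure_ne_top _ _)).comp hport
  rw [← tendsto_add_atTop_iff_nat 1]
  have hvol : volume.real (Set.univ.pi I) = (volume (Set.univ.pi B)).toReal := by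
    rw [Measure.real, volume_pi_pi, volume_pi_pi]
    simp_rw [hB, fun i => volume_circleSet (hI i).1 (hI i).2]
  rw [hvol]
  refine hreal.congr fun N => ?_
  refine (empiricalMeasure_toReal y N hBm).trans ?_
  congr 3
  refine Finset.filter_congr fun n _ => ?_
  simp only [Set.mem_pi, Set.mem_univ, true_implies, hB, hy, coe_mem_circleSet]

/-! ### Linear algebra modulo constants and the conclusion -/

lemma pairWeight_mul_le {δ v : ℝ} (hδ : 0 ≤ δ) (hv : 1 ≤ |v|) (t : ℝ) :
    pairWeight δ (v * t) ≤ pairWeight δ t := by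
  have hv0 : v ≠ 0 := fun h => by simp [h] at hv; linarith
  unfold pairWeight
  by_cases ht : t = 0
  · simp [ht]
  · rw [if_neg ht, if_neg (mul_ne_zero hv0 ht)]
    refine min_le_min_right _ (Real.rpow_le_rpow_of_nonpos (abs_pos.2 ht) ?_ (by linarith))
    rw [abs_mul]
    exact le_mul_of_one_le_left (abs_nonneg t) hv

lemma IsScattered.const_mul {a : ℕ → ℝ} (ha : IsScattered a) {v : ℝ} (hv : 1 ≤ |v|) :
    IsScattered fun n => v * a n := by
  intro δ hδ hδ1
  obtain ⟨ε, hε, hev⟩ := ha δ hδ hδ1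
  refine ⟨ε, hε, hev.mono fun N hN => le_trans ?_ hN⟩
  gcongr with n _ m _
  rw [← mul_sub]
  exact pairWeight_mul_le hδ.le hv _

lemma ae_of_forall_ae_restrict_Ioc {P : ℝ → Prop}
    (h : ∀ R : ℕ, ∀ᵐ x ∂(volume.restrict (Set.Ioc (-(R : ℝ)) R)), P x) : ∀ᵐ x, P x := by
  have h1 : ∀ R : ℕ, ∀ᵐ x : ℝ, x ∈ Set.Ioc (-(R : ℝ)) R → P x := fun R =>
    (ae_restrict_iff' measurableSet_Ioc).1 (h R)
  filter_upwards [ae_all_iff.2 h1] with x hx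
  obtain ⟨R, hR⟩ := exists_nat_gt |x|
  exact hx R ⟨(abs_lt.1 hR).1, (abs_lt.1 hR).2.le⟩

/-- Exponential averages with phases `γ n + ∑ i, β i n * g i x` vanish almost everywhere if a single
coefficient sequence is scattered; the phase shifts `γ n` do not affect the size of correlations. -/
lemma ae_tendsto_exp_average_zero {ι : Type*} [Fintype ι] {g : ι → ℝ → ℝ}
    (hg : ∀ i, AnalyticOnNhd ℝ (g i) Set.univ)
    (hind : ∀ u : ι → ℝ, u ≠ 0 → ¬ ∃ c : ℝ, ∀ x, ∑ i, u i * g i x = c)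
    (β : ι → ℕ → ℝ) (γ : ℕ → ℝ) {j : ι} (hj : IsScattered (β j)) :
    ∀ᵐ x : ℝ, Tendsto (fun N : ℕ => (1 / (N : ℂ)) * ∑ n ∈ Finset.Icc 1 N,
      Complex.exp (2 * Real.pi * Complex.I * (γ n + ∑ i, β i n * g i x : ℝ))) atTop (𝓝 0) := by
  refine ae_of_forall_ae_restrict_Ioc fun R => ?_
  have hR : -(R : ℝ) ≤ R := by linarith [Nat.cast_nonneg (α := ℝ) R]
  obtain ⟨δ, C, hδ, hδ1, hC, hbound⟩ := exists_norm_integral_exp_le_pairWeight hg hind hR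
  have hgc : ∀ i, Continuous (g i) := fun i => (hg i).continuous
  have hnorm : ∀ r : ℝ, ‖Complex.exp (2 * Real.pi * Complex.I * r)‖ = 1 := fun r => by
    rw [show (2 * Real.pi * Complex.I * r : ℂ) = ((2 * Real.pi * r : ℝ) : ℂ) * Complex.I by
      push_cast; ring]
    exact Complex.norm_exp_ofReal_mul_I _
  refine ae_tendsto_average_zero hR (fun n => by fun_prop) (fun n x => hnorm _) hC (hj δ hδ hδ1)
    fun n m => ?_
  have hprod : ∀ x, Complex.exp (2 * Real.pi * Complex.I * (γ n + ∑ i, β i n * g i x : ℝ))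
      * (starRingEnd ℂ) (Complex.exp (2 * Real.pi * Complex.I * (γ m + ∑ i, β i m * g i x : ℝ)))
      = Complex.exp (2 * Real.pi * Complex.I * (γ n - γ m : ℝ))
        * Complex.exp (2 * Real.pi * Complex.I * (∑ i, (β i n - β i m) * g i x : ℝ)) := by
    intro x
    rw [← Complex.exp_conj, ← Complex.exp_add, ← Complex.exp_add]
    congr 1
    simp only [map_mul, Complex.conj_I, Complex.conj_ofReal, map_ofNat]
    simp only [sub_mul, Finset.sum_sub_distrib]
    push_cast
    ring
  simp_rw [hprod]
  rw [intervalIntegral.integral_const_mul, norm_mul, hnorm, one_mul]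
  exact hbound (fun i => β i n - β i m) j

/-- Finitely many functions are combinations, up to additive constants, of a subfamily no
non-trivial combination of which is constant. -/
lemma exists_subfamily_independent_mod_const {ι : Type} [Finite ι] (f : ι → ℝ → ℝ) :
    ∃ (κ : Type) (_ : Fintype κ) (s : κ → ι),
      (∀ u : κ → ℝ, u ≠ 0 → ¬ ∃ c : ℝ, ∀ x, ∑ j, u j * f (s j) x = c) ∧
      ∀ i, ∃ (c : ℝ) (w : κ → ℝ), ∀ x, f i x = c + ∑ j, w j * f (s j) x := by
  set S : Submodule ℝ (ℝ → ℝ) := Submodule.span ℝ {fun _ => 1} with hS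
  obtain ⟨κ, s, hinj, hspan, hli⟩ := exists_linearIndependent' ℝ fun i => S.mkQ (f i)
  have : Finite κ := Finite.of_injective s hinj
  have := Fintype.ofFinite κ
  refine ⟨κ, inferInstance, s, ?_, fun i => ?_⟩
  · rintro u hu ⟨c, hc⟩
    refine hu (funext (Fintype.linearIndependent_iff.1 hli u ?_))
    have h1 : ∑ j, u j • f (s j) ∈ S := by
      refine Submodule.mem_span_singleton.2 ⟨c, ?_⟩
      ext x
      simp [← hc x]
    have h2 := (Submodule.Quotient.mk_eq_zero S).2 h1
    rw [← Submodule.mkQ_apply, map_sum] at h2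
    simpa using h2
  · have h1 : S.mkQ (f i) ∈ Submodule.span ℝ (Set.range ((fun i => S.mkQ (f i)) ∘ s)) := by
      rw [hspan]
      exact Submodule.subset_span ⟨i, rfl⟩
    obtain ⟨w, hw⟩ := Submodule.mem_span_range_iff_exists_fun ℝ |>.1 h1
    have h2 : f i - ∑ j, w j • f (s j) ∈ S := by
      rw [← Submodule.Quotient.mk_eq_zero, ← Submodule.mkQ_apply, map_sub, map_sum, sub_eq_zero,
        ← hw]
      simp
    obtain ⟨c, hc⟩ := Submodule.mem_span_singleton.1 h2
    refine ⟨c, w, fun x => ?_⟩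
    have := congrFun hc x
    simp at this
    linarith

lemma sum_mul_ne_const_of_linearIndependent {k : ℕ} {f : Fin k → ℝ → ℝ}
    (h : LinearIndependent ℝ (Fin.cons (fun _ => 1) f : Fin (k + 1) → ℝ → ℝ)) (u : Fin k → ℝ)
    (hu : u ≠ 0) : ¬ ∃ c : ℝ, ∀ x, ∑ i, u i * f i x = c := by
  rintro ⟨c, hc⟩
  refine hu (funext fun i => ?_)
  have h1 := Fintype.linearIndependent_iff.1 h (Fin.cons (-c) u) (by
    ext x
    simp [Fin.sum_univ_succ, hc x]) i.succ
  simpa using h1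

theorem mainTheorem1 (k : ℕ) (hk : 1 ≤ k) (f : Fin k → ℝ → ℝ) (a : Fin k → ℕ → ℝ)
    (hf : ∀ i, AnalyticOnNhd ℝ (f i) Set.univ)
    (hfc : ∀ i, ¬ ∃ c : ℝ, ∀ x : ℝ, f i x = c)
    (ha : ∀ i, IsScattered (a i))
    (h : JointlyScattered a ∨
      LinearIndependent ℝ (Fin.cons (fun _ => 1) f : Fin (k + 1) → ℝ → ℝ)) :
    ∀ᵐ x : ℝ ∂volume, IsUniformlyDistributedModOne (fun n i => a i n * f i x) := by
  suffices H : ∀ v : Fin k → ℤ, v ≠ 0 → ∀ᵐ x : ℝ, Tendsto (fun N : ℕ => (1 / (N : ℂ)) *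
      ∑ n ∈ Finset.Icc 1 N, Complex.exp (2 * Real.pi * Complex.I *
        (∑ i, v i * (a i n * f i x) : ℝ))) atTop (𝓝 0) by
    have H' : ∀ v : Fin k → ℤ, ∀ᵐ x : ℝ, v ≠ 0 → _ := fun v => eventually_imp_distrib_left.2 (H v)
    filter_upwards [ae_all_iff.2 H'] with x hx
    exact isUniformlyDistributedModOne_of_tendsto_exp hx
  intro v hv
  obtain ⟨i₀, hi₀⟩ := Function.ne_iff.1 hv
  rcases h with hjoint | hli
  · obtain ⟨κ, _, s, hind, hrep⟩ := exists_subfamily_independent_mod_const f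
    choose c w hw using hrep
    -- `f i₀` is not constant, so it involves some function `f (s j)` of the subfamily
    obtain ⟨j, hj⟩ : ∃ j, w i₀ j ≠ 0 := by
      by_contra! hzero
      exact hfc i₀ ⟨c i₀, fun x => by rw [hw i₀ x]; simp [hzero]⟩
    have hne : (fun i => v i * w i j) ≠ 0 := by
      refine Function.ne_iff.2 ⟨i₀, mul_ne_zero ?_ hj⟩
      exact_mod_cast hi₀
    have key := ae_tendsto_exp_average_zero (fun l => hf (s l)) hind
      (fun l n => ∑ i, v i * w i l * a i n) (fun n => ∑ i, v i * a i n * c i) (hjoint _ hne)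
    have hphase : ∀ n x, ∑ i, v i * (a i n * f i x)
        = ∑ i, v i * a i n * c i + ∑ l, (∑ i, v i * w i l * a i n) * f (s l) x := by
      intro n x
      simp_rw [Finset.sum_mul]
      rw [Finset.sum_comm, ← Finset.sum_add_distrib]
      refine Finset.sum_congr rfl fun i _ => ?_
      rw [hw i x, mul_add, mul_add, Finset.mul_sum, Finset.mul_sum, ← mul_assoc]
      congr 1
      exact Finset.sum_congr rfl fun l _ => by ring
    simp_rw [hphase]
    exact key
  · have hv1 : (1 : ℝ) ≤ |(v i₀ : ℝ)| := by
      exact_mod_cast Int.one_le_abs hi₀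
    have key := ae_tendsto_exp_average_zero hf (sum_mul_ne_const_of_linearIndependent hli)
      (fun i n => v i * a i n) (fun _ => 0) ((ha i₀).const_mul hv1)
    simpa only [zero_add, mul_assoc] using key
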